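/- Let $S$ be a finite inverse semigroup (every $s\in S$ has a unique $s^{-1}\in S$ with $ss^{-1}s=s$ and $s^{-1}ss^{-1}=s^{-1}$) and let $K$ be a field of characteristic $0$. Put $\operatorname{dom}s=ss^{-1}$, $\operatorname{ran}s=s^{-1}s$. Order the set $E(S)$ of idempotents by $e\le f\iff ef=e=fe$, with Möbius function $\mu$, and order $S$ by $s\le t\iff s=et$ for some $e\in E(S)$. Call $e,f\in E(S)$ isomorphic if some $s\in S$ has $\operatorname{dom}s=e$ and $\operatorname{ran}s=f$. Let $G_e=\{s\in S:\operatorname{dom}s=e=\operatorname{ran}s\}$ be the maximal subgroup at $e$. Fix $e\in E(S)$, let $\varphi:G_e\to\operatorname{End}_K(W)$ be a finite-dimensional irreducible representation with character $\chi$, and let $d=\dim_K\operatorname{End}_{KG_e}(W)$ be the dimension of its endomorphism division algebra. For each idempotent $f$ isomorphic to $e$ choose $p_f\in S$ with $\operatorname{dom}p_f=e$, $\operatorname{ran}p_f=f$. The induced representation $\varphi^*$ of $S$ acts on the direct sum of copies of $W$ indexed by the idempotents isomorphic to $e$, by the block matrices $$\varphi^*(s)=\sum_{t\le s,\ \operatorname{dom}t\text{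 isomorphic to }e}\varphi\bigl(p_{\operatorname{dom}t}\,t\,p_{\operatorname{ran}t}^{-1}\bigr)\,E_{\operatorname{dom}t,\operatorname{ran}t},$$ where $E_{f,g}$ are the matrix units; let $\chi^*$ be its character. Let $\theta$ be the character of a finite-dimensional representation $\rho:S\to\operatorname{End}_K(V)$ (a multiplicative map), put $\theta_f(s)=\theta(fs)$ for $f\in E(S)$, and set $$(\psi,\alpha)_{G_e}=\frac1{|G_e|}\sum_{g\in G_e}\psi(g^{-1})\alpha(g),\qquad (\chi,\theta)_S:=\sum_{f\le e}(\chi,\theta_f)_{G_e}\,\mu(f,e).$$ Then $\varphi^*$ is irreducible, $\rho$ is a direct sum of irreducible subrepresentations, and, if $m$ denotes the multiplicity of $\chi^*$ in $\theta$ (the number of summands equivalent to $\varphi^*$ in any such decomposition), $$(\chi,\theta)_S=\sum_{f\le e}(\chi,\theta_f)_{G_e}\,\mu(f,e)=m\,d .$$ -/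

import Mathlib

/-- An inverse semigroup: every `s` has exactly one `t` with `sts = s` and `tst = t`,
and this `t` is written `s⁻¹`. -/
class InverseSemigroup (S : Type*) extends Semigroup S, Inv S where
  mul_inv_mul (s : S) : s * s⁻¹ * s = s
  inv_mul_inv (s : S) : s⁻¹ * s * s⁻¹ = s⁻¹
  eq_inv_of (s t : S) : s * t * s = s → t * s * t = t → t = s⁻¹

namespace InverseSemigroup

section Basic

variable {S : Type*} [InverseSemigroup S]

theorem mul_inv_mul' (s : S) : s * (s⁻¹ * s) = s := by
  rw [← mul_assoc, mul_inv_mul]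

theorem inv_mul_inv' (s : S) : s⁻¹ * (s * s⁻¹) = s⁻¹ := by
  rw [← mul_assoc, inv_mul_inv]

theorem inv_involutive (s : S) : (s⁻¹)⁻¹ = s :=
  (eq_inv_of s⁻¹ s (inv_mul_inv s) (mul_inv_mul s)).symm

theorem idem_inv {e : S} (he : e * e = e) : e⁻¹ = e :=
  (eq_inv_of e e (by rw [he, he]) (by rw [he, he])).symm

theorem idem_mul_idem {e f : S} (he : e * e = e) (hf : f * f = f) :
    (e * f) * (e * f) = e * f := by
  set x := (e * f)⁻¹ with hx
  have h1 : (e * f) * x * (e * f) = e * f := mul_inv_mul _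
  have h2 : x * (e * f) * x = x := inv_mul_inv _
  have he' : ∀ a : S, e * (e * a) = e * a := fun a => by rw [← mul_assoc, he]
  have hf' : ∀ a : S, f * (f * a) = f * a := fun a => by rw [← mul_assoc, hf]
  simp only [mul_assoc] at h1 h2
  have h2' : ∀ a : S, x * (e * (f * (x * a))) = x * a := fun a => by
    have := congrArg (· * a) h2
    simpa only [mul_assoc] using this
  have h3 : f * (x * e) = x := by
    rw [hx]
    refine eq_inv_of _ _ ?_ ?_ <;> rw [← hx]
    · simp only [mul_assoc, he', hf', h1]
    · simp only [mul_assoc, he', hf', h2']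
  have h4 : x * x = x := by
    calc x * x = (f * (x * e)) * (f * (x * e)) := by rw [h3]
      _ = f * (x * e) := by simp only [mul_assoc, h2']
      _ = x := h3
  have h5 : e * f = x := by
    rw [← inv_involutive (e * f), ← hx, idem_inv h4]
  rw [h5, h4]

theorem idem_comm {e f : S} (he : e * e = e) (hf : f * f = f) : e * f = f * e := by
  have hef := idem_mul_idem he hf
  have hfe := idem_mul_idem hf he
  have he' : ∀ a : S, e * (e * a) = e * a := fun a => by rw [← mul_assoc, he]
  have hf' : ∀ a : S, f * (f * a) = f * a := fun a => by rw [← mul_assoc, hf]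
  have h : f * e = (e * f)⁻¹ := by
    refine eq_inv_of _ _ ?_ ?_
    · simp only [mul_assoc, he', hf'] at hef ⊢
      exact hef
    · simp only [mul_assoc, he', hf'] at hfe ⊢
      exact hfe
  rw [h, idem_inv hef]

theorem mul_inv_idem (s : S) : (s * s⁻¹) * (s * s⁻¹) = s * s⁻¹ := by
  rw [← mul_assoc, mul_inv_mul]

theorem inv_mul_idem (s : S) : (s⁻¹ * s) * (s⁻¹ * s) = s⁻¹ * s := by
  rw [← mul_assoc, inv_mul_inv]

theorem mul_inv_rev' (s t : S) : (s * t)⁻¹ = t⁻¹ * s⁻¹ := by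
  have h := idem_comm (mul_inv_idem t) (inv_mul_idem s)
  symm
  refine eq_inv_of _ _ ?_ ?_
  · calc s * t * (t⁻¹ * s⁻¹) * (s * t) = s * ((t * t⁻¹) * (s⁻¹ * s)) * t := by
          simp only [mul_assoc]
      _ = (s * s⁻¹ * s) * (t * t⁻¹ * t) := by rw [h]; simp only [mul_assoc]
      _ = s * t := by rw [mul_inv_mul, mul_inv_mul]
  · calc t⁻¹ * s⁻¹ * (s * t) * (t⁻¹ * s⁻¹) = t⁻¹ * ((s⁻¹ * s) * (t * t⁻¹)) * s⁻¹ := by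
          simp only [mul_assoc]
      _ = (t⁻¹ * t * t⁻¹) * (s⁻¹ * s * s⁻¹) := by rw [← h]; simp only [mul_assoc]
      _ = t⁻¹ * s⁻¹ := by rw [inv_mul_inv, inv_mul_inv]

end Basic

section Idempotents

/-- The set `E(S)` of idempotents. -/
@[ext]
structure Idem (S : Type*) [InverseSemigroup S] where
  /-- the underlying element -/
  val : S
  idem : val * val = val

variable {S : Type*} [InverseSemigroup S]

/-- The order on `E(S)`: `e ≤ f` if and only if `ef = e = fe`. -/
instance : PartialOrder (Idem S) where
  le e f := e.1 * f.1 = e.1 ∧ f.1 * e.1 = e.1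
  le_refl e := ⟨e.idem, e.idem⟩
  le_trans e f g hef hfg :=
    ⟨by rw [← hef.1, mul_assoc, hfg.1], by rw [← hef.2, ← mul_assoc, hfg.2]⟩
  le_antisymm e f hef hfe := Idem.ext (hef.1.symm.trans hfe.2)

noncomputable instance [Fintype S] : Fintype (Idem S) :=
  Fintype.ofInjective Idem.val fun _ _ => Idem.ext

open Classical in
/-- The Möbius function of the finite poset `E(S)`, with values in `K`. -/
noncomputable def moebius (K : Type*) [Field K] [Fintype S] (e f : Idem S) : K :=
  letI : LocallyFiniteOrder (Idem S) := Fintype.toLocallyFiniteOrder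
  IncidenceAlgebra.mu K e f

/-- `dom s = s s⁻¹`. -/
def dom (s : S) : Idem S := ⟨s * s⁻¹, mul_inv_idem s⟩

/-- `ran s = s⁻¹ s`. -/
def ran (s : S) : Idem S := ⟨s⁻¹ * s, inv_mul_idem s⟩

/-- The natural partial order: `s ≤ t` if and only if `s = e t` for some idempotent `e`. -/
def NatLE (s t : S) : Prop := ∃ e : Idem S, s = e.1 * t

theorem dom_inv (s : S) : dom s⁻¹ = ran s :=
  Idem.ext (by change s⁻¹ * (s⁻¹)⁻¹ = s⁻¹ * s; rw [inv_involutive])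

theorem ran_inv (s : S) : ran s⁻¹ = dom s :=
  Idem.ext (by change (s⁻¹)⁻¹ * s⁻¹ = s * s⁻¹; rw [inv_involutive])

theorem dom_mul {s t : S} (h : ran s = dom t) : dom (s * t) = dom s := by
  have h' : s⁻¹ * s = t * t⁻¹ := congrArg Idem.val h
  refine Idem.ext ?_
  change s * t * (s * t)⁻¹ = s * s⁻¹
  calc s * t * (s * t)⁻¹ = s * (t * t⁻¹) * s⁻¹ := by rw [mul_inv_rev']; simp only [mul_assoc]
    _ = s * s⁻¹ := by rw [← h', ← mul_assoc, mul_inv_mul]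

theorem ran_mul {s t : S} (h : ran s = dom t) : ran (s * t) = ran t := by
  have h' : s⁻¹ * s = t * t⁻¹ := congrArg Idem.val h
  refine Idem.ext ?_
  change (s * t)⁻¹ * (s * t) = t⁻¹ * t
  calc (s * t)⁻¹ * (s * t) = t⁻¹ * (s⁻¹ * s) * t := by rw [mul_inv_rev']; simp only [mul_assoc]
    _ = t⁻¹ * t := by rw [h', ← mul_assoc, inv_mul_inv]

theorem dom_mul_self (s : S) : (dom s).1 * s = s := mul_inv_mul s

theorem mul_ran_self (s : S) : s * (ran s).1 = s := mul_inv_mul' s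

theorem natLE_mul_idem (s : S) (f : Idem S) : NatLE (s * f.1) s := by
  refine ⟨⟨s * f.1 * s⁻¹, ?_⟩, ?_⟩
  · calc s * f.1 * s⁻¹ * (s * f.1 * s⁻¹) = s * (f.1 * (s⁻¹ * s)) * (f.1 * s⁻¹) := by
          simp only [mul_assoc]
      _ = (s * s⁻¹ * s) * (f.1 * f.1) * s⁻¹ := by
          rw [idem_comm f.idem (inv_mul_idem s)]; simp only [mul_assoc]
      _ = s * f.1 * s⁻¹ := by rw [mul_inv_mul, f.idem]
  · calc s * f.1 = (s * s⁻¹ * s) * f.1 := by rw [mul_inv_mul]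
      _ = s * ((s⁻¹ * s) * f.1) := by simp only [mul_assoc]
      _ = s * f.1 * s⁻¹ * s := by rw [idem_comm (inv_mul_idem s) f.idem]; simp only [mul_assoc]

theorem NatLE.eq_dom_mul {t s : S} (h : NatLE t s) : (dom t).1 * s = t := by
  obtain ⟨e, rfl⟩ := h
  change e.1 * s * (e.1 * s)⁻¹ * s = e.1 * s
  calc e.1 * s * (e.1 * s)⁻¹ * s = e.1 * ((s * s⁻¹) * e.1) * s := by
        rw [mul_inv_rev', idem_inv e.idem]; simp only [mul_assoc]
    _ = (e.1 * e.1) * (s * s⁻¹ * s) := by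
        rw [idem_comm (mul_inv_idem s) e.idem]; simp only [mul_assoc]
    _ = e.1 * s := by rw [e.idem, mul_inv_mul]

theorem NatLE.eq_mul_ran {t s : S} (h : NatLE t s) : s * (ran t).1 = t := by
  obtain ⟨e, rfl⟩ := h
  change s * ((e.1 * s)⁻¹ * (e.1 * s)) = e.1 * s
  calc s * ((e.1 * s)⁻¹ * (e.1 * s)) = (s * s⁻¹) * (e.1 * e.1) * s := by
        rw [mul_inv_rev', idem_inv e.idem]; simp only [mul_assoc]
    _ = e.1 * (s * s⁻¹ * s) := by
        rw [e.idem, idem_comm (mul_inv_idem s) e.idem]; simp only [mul_assoc]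
    _ = e.1 * s := by rw [mul_inv_mul]

theorem NatLE.mul {t s t' s' : S} (h : NatLE t s) (h' : NatLE t' s') :
    NatLE (t * t') (s * s') := by
  obtain ⟨e, he⟩ := natLE_mul_idem (s * s') (ran t')
  refine ⟨⟨(dom t).1 * e.1, idem_mul_idem (dom t).idem e.idem⟩, ?_⟩
  calc t * t' = ((dom t).1 * s) * (s' * (ran t').1) := by rw [h.eq_dom_mul, h'.eq_mul_ran]
    _ = (dom t).1 * (s * s' * (ran t').1) := by simp only [mul_assoc]
    _ = (dom t).1 * e.1 * (s * s') := by rw [he, mul_assoc]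

/-- If `u ≤ s s'` then `dom u · s` and `s' · ran u` are composable. -/
theorem ran_dom_mul_eq {u s s' : S} (h : NatLE u (s * s')) :
    ran ((dom u).1 * s) = dom (s' * (ran u).1) := by
  have h1 : u * u⁻¹ * (s * s') = u := h.eq_dom_mul
  have h2 : (s * s') * (u⁻¹ * u) = u := h.eq_mul_ran
  have h3 : s' * u⁻¹ = (u * u⁻¹ * s)⁻¹ := by
    refine eq_inv_of _ _ ?_ ?_
    · calc u * u⁻¹ * s * (s' * u⁻¹) * (u * u⁻¹ * s)
          = (u * u⁻¹ * (s * s')) * (u⁻¹ * u * u⁻¹) * s := by simp only [mul_assoc]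
        _ = u * u⁻¹ * s := by rw [h1, inv_mul_inv]
    · calc s' * u⁻¹ * (u * u⁻¹ * s) * (s' * u⁻¹)
          = s' * (u⁻¹ * (u * u⁻¹ * (s * s')) * u⁻¹) := by simp only [mul_assoc]
        _ = s' * u⁻¹ := by rw [h1, inv_mul_inv]
  have h4 : u⁻¹ * s = (s' * (u⁻¹ * u))⁻¹ := by
    refine eq_inv_of _ _ ?_ ?_
    · calc s' * (u⁻¹ * u) * (u⁻¹ * s) * (s' * (u⁻¹ * u))
          = s' * ((u⁻¹ * u * u⁻¹) * ((s * s') * (u⁻¹ * u))) := by simp only [mul_assoc]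
        _ = s' * (u⁻¹ * u) := by rw [h2, inv_mul_inv]
    · calc u⁻¹ * s * (s' * (u⁻¹ * u)) * (u⁻¹ * s)
          = u⁻¹ * ((s * s') * (u⁻¹ * u)) * u⁻¹ * s := by simp only [mul_assoc]
        _ = u⁻¹ * s := by rw [h2, inv_mul_inv]
  refine Idem.ext ?_
  change (u * u⁻¹ * s)⁻¹ * (u * u⁻¹ * s) = s' * (u⁻¹ * u) * (s' * (u⁻¹ * u))⁻¹
  rw [← h3, ← h4]
  simp only [mul_assoc]

/-- Two idempotents `e`, `f` are isomorphic (`e 𝒟 f`) if some `s` has `dom s = e`, `ran s = f`. -/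
def Isomorphic (e f : Idem S) : Prop := ∃ s : S, dom s = e ∧ ran s = f

theorem Isomorphic.trans {e f g : Idem S} (h : Isomorphic e f) (h' : Isomorphic f g) :
    Isomorphic e g := by
  obtain ⟨s, hs, hs'⟩ := h
  obtain ⟨t, ht, ht'⟩ := h'
  exact ⟨s * t, (dom_mul (hs'.trans ht.symm)).trans hs, (ran_mul (hs'.trans ht.symm)).trans ht'⟩

theorem isomorphic_dom_ran (t : S) : Isomorphic (dom t) (ran t) := ⟨t, rfl, rfl⟩

theorem isomorphic_ran_dom (t : S) : Isomorphic (ran t) (dom t) := ⟨t⁻¹, dom_inv t, ran_inv t⟩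

end Idempotents

section MaxSubgroup

variable {S : Type*} [InverseSemigroup S]

/-- The maximal subgroup `G_e = {s | dom s = e = ran s}`. -/
@[ext]
structure MaxSubgroup (e : Idem S) where
  /-- the underlying element -/
  val : S
  dom_eq : dom val = e
  ran_eq : ran val = e

/-- `G_e` is a group with the multiplication and the inverse of `S` and the identity `e`. -/
instance (e : Idem S) : Group (MaxSubgroup e) where
  mul a b := ⟨a.val * b.val, (dom_mul (a.ran_eq.trans b.dom_eq.symm)).trans a.dom_eq,
    (ran_mul (a.ran_eq.trans b.dom_eq.symm)).trans b.ran_eq⟩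
  one := ⟨e.val, Idem.ext (by change e.val * e.val⁻¹ = e.val; rw [idem_inv e.idem, e.idem]),
    Idem.ext (by change e.val⁻¹ * e.val = e.val; rw [idem_inv e.idem, e.idem])⟩
  inv a := ⟨a.val⁻¹, (dom_inv a.val).trans a.ran_eq, (ran_inv a.val).trans a.dom_eq⟩
  mul_assoc a b c := MaxSubgroup.ext (mul_assoc a.val b.val c.val)
  one_mul a := MaxSubgroup.ext (by
    have h := dom_mul_self a.val
    rwa [a.dom_eq] at h)
  mul_one a := MaxSubgroup.ext (by
    have h := mul_ran_self a.val
    rwa [a.ran_eq] at h)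
  inv_mul_cancel a := MaxSubgroup.ext (congrArg Idem.val a.ran_eq)

noncomputable instance [Fintype S] (e : Idem S) : Fintype (MaxSubgroup e) :=
  Fintype.ofInjective MaxSubgroup.val fun _ _ => MaxSubgroup.ext

end MaxSubgroup

section Representations

/-- A representation of a semigroup `S` on the `K`-space `V`. -/
abbrev SemigroupRep (K S V : Type*) [Field K] [Semigroup S] [AddCommGroup V] [Module K V] :=
  S →ₙ* Module.End K V

variable {K S V W : Type*} [Field K] [Semigroup S] [AddCommGroup V] [Module K V]
  [AddCommGroup W] [Module K W]

/-- The character `s ↦ tr (ρ s)`. -/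
noncomputable def character (ρ : SemigroupRep K S V) (s : S) : K := LinearMap.trace K V (ρ s)

/-- `S`-invariant subspaces. -/
def IsInvariant (ρ : SemigroupRep K S V) (U : Submodule K V) : Prop :=
  ∀ s : S, ∀ v ∈ U, ρ s v ∈ U

/-- The subrepresentation on an invariant subspace. -/
def subrep (ρ : SemigroupRep K S V) (U : Submodule K V) (hU : IsInvariant ρ U) :
    SemigroupRep K S U where
  toFun s := (ρ s).restrict (hU s)
  map_mul' s t := by
    ext v
    simp

/-- A representation is irreducible if it is nonzero and has no proper nonzero
invariant subspace. -/
def IsIrreducible (ρ : SemigroupRep K S V) : Prop :=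
  Nontrivial V ∧ ∀ U : Submodule K V, IsInvariant ρ U → U = ⊥ ∨ U = ⊤

/-- Equivalence of representations. -/
def Equivalent (ρ : SemigroupRep K S V) (σ : SemigroupRep K S W) : Prop :=
  ∃ T : V ≃ₗ[K] W, ∀ s v, T (ρ s v) = σ s (T v)

/-- `m` is the multiplicity of `σ` in `ρ`: for some decomposition of `ρ` into a direct sum of
irreducible subrepresentations, exactly `m` of the summands are equivalent to `σ`. -/
def IsMultiplicity (σ : SemigroupRep K S W) (ρ : SemigroupRep K S V) (m : ℕ) : Prop :=
  ∃ (k : ℕ) (U : Fin k → Submodule K V) (hU : ∀ i, IsInvariant ρ (U i)),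
    DirectSum.IsInternal U ∧ (∀ i, IsIrreducible (subrep ρ (U i) (hU i))) ∧
      m = Nat.card {i : Fin k // Equivalent (subrep ρ (U i) (hU i)) σ}

end Representations

section Induced

variable {S : Type*} [InverseSemigroup S]

/-- A choice, for each idempotent `f` isomorphic to `e`, of an element `p f` with
`dom (p f) = e` and `ran (p f) = f`. -/
structure Transversal (e : Idem S) where
  /-- the chosen elements -/
  toFun : {f : Idem S // Isomorphic e f} → S
  dom_eq : ∀ f, dom (toFun f) = e
  ran_eq : ∀ f, ran (toFun f) = f.1

instance (e : Idem S) : Nonempty (Transversal e) :=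
  ⟨⟨fun f => f.2.choose, fun f => f.2.choose_spec.1, fun f => f.2.choose_spec.2⟩⟩

variable {e : Idem S}

/-- For `dom t = f` and `ran t = g`, with `f`, `g` isomorphic to `e`, the element
`p_f t p_g⁻¹` of `G_e`. -/
def Transversal.conj (p : Transversal e) (f g : {f : Idem S // Isomorphic e f}) (t : S)
    (hf : dom t = f.1) (hg : ran t = g.1) : MaxSubgroup e :=
  ⟨p.toFun f * t * (p.toFun g)⁻¹, by
    have h1 : ran (p.toFun f) = dom t := (p.ran_eq f).trans hf.symm
    have h2 : ran (p.toFun f * t) = dom (p.toFun g)⁻¹ := by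
      rw [ran_mul h1, dom_inv, p.ran_eq g, hg]
    rw [dom_mul h2, dom_mul h1, p.dom_eq], by
    have h1 : ran (p.toFun f) = dom t := (p.ran_eq f).trans hf.symm
    have h2 : ran (p.toFun f * t) = dom (p.toFun g)⁻¹ := by
      rw [ran_mul h1, dom_inv, p.ran_eq g, hg]
    rw [ran_mul h2, ran_inv, p.dom_eq]⟩

theorem Transversal.conj_mul (p : Transversal e) (f g k : {f : Idem S // Isomorphic e f}) (s t : S)
    (hf : dom s = f.1) (hg : ran s = g.1) (hg' : dom t = g.1) (hk : ran t = k.1)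
    (h : dom (s * t) = f.1) (h' : ran (s * t) = k.1) :
    p.conj f k (s * t) h h' = p.conj f g s hf hg * p.conj g k t hg' hk := by
  refine MaxSubgroup.ext ?_
  change p.toFun f * (s * t) * (p.toFun k)⁻¹
    = p.toFun f * s * (p.toFun g)⁻¹ * (p.toFun g * t * (p.toFun k)⁻¹)
  have h1 : (p.toFun g)⁻¹ * p.toFun g = s⁻¹ * s :=
    congrArg Idem.val ((p.ran_eq g).trans hg.symm)
  calc p.toFun f * (s * t) * (p.toFun k)⁻¹
      = p.toFun f * ((s * (s⁻¹ * s)) * t) * (p.toFun k)⁻¹ := by rw [mul_inv_mul']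
    _ = _ := by rw [← h1]; simp only [mul_assoc]

variable {K W : Type*} [Field K] [AddCommGroup W] [Module K W]

open Classical in
/-- The block matrix with the block `φ x` in row `f` and column `g` and zeros elsewhere, as an
endomorphism of the direct sum of copies of `W` indexed by the idempotents isomorphic to `e`. -/
noncomputable def blockUnit (φ : Representation K (MaxSubgroup e) W)
    (f g : {f : Idem S // Isomorphic e f}) (x : MaxSubgroup e) :
    Module.End K ({f : Idem S // Isomorphic e f} → W) :=
  LinearMap.single K (fun _ => W) f ∘ₗ φ x ∘ₗ LinearMap.proj g

theorem blockUnit_mul (φ : Representation K (MaxSubgroup e) W)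
    (f g k : {f : Idem S // Isomorphic e f}) (x y : MaxSubgroup e) :
    blockUnit φ f g x * blockUnit φ g k y = blockUnit φ f k (x * y) := by
  refine LinearMap.ext fun v => ?_
  simp [blockUnit]

theorem blockUnit_mul_of_ne (φ : Representation K (MaxSubgroup e) W)
    (f g g' k : {f : Idem S // Isomorphic e f}) (x y : MaxSubgroup e) (h : g ≠ g') :
    blockUnit φ f g x * blockUnit φ g' k y = 0 := by
  refine LinearMap.ext fun v => ?_
  simp [blockUnit, h]

open Classical in
/-- The image of the basis element `⌊t⌋ = ∑_{u ≤ t} μ(u,t) u` of the semigroup algebra under the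
induced representation: the block `φ (p_f t p_g⁻¹)` in row `f = dom t` and column `g = ran t` if
`t` lies in the `𝒟`-class of `e`, and zero otherwise. -/
noncomputable def floorMap (φ : Representation K (MaxSubgroup e) W) (p : Transversal e) (t : S) :
    Module.End K ({f : Idem S // Isomorphic e f} → W) :=
  if h : Isomorphic e (dom t) then
    blockUnit φ ⟨dom t, h⟩ ⟨ran t, h.trans (isomorphic_dom_ran t)⟩
      (p.conj ⟨dom t, h⟩ ⟨ran t, h.trans (isomorphic_dom_ran t)⟩ t rfl rfl)
  else 0

theorem floorMap_eq (φ : Representation K (MaxSubgroup e) W) (p : Transversal e) (t : S)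
    (f g : {f : Idem S // Isomorphic e f}) (hf : dom t = f.1) (hg : ran t = g.1) :
    floorMap φ p t = blockUnit φ f g (p.conj f g t hf hg) := by
  obtain ⟨f, hf'⟩ := f
  obtain ⟨g, hg'⟩ := g
  dsimp only at hf hg
  subst hf hg
  rw [floorMap, dif_pos hf']

open Classical in
theorem floorMap_mul (φ : Representation K (MaxSubgroup e) W) (p : Transversal e) (s t : S) :
    floorMap φ p s * floorMap φ p t = if ran s = dom t then floorMap φ p (s * t) else 0 := by
  by_cases hs : Isomorphic e (dom s)
  · have hs' := hs.trans (isomorphic_dom_ran s)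
    by_cases ht : Isomorphic e (dom t)
    · have ht' := ht.trans (isomorphic_dom_ran t)
      by_cases h : ran s = dom t
      · rw [if_pos h, floorMap_eq φ p s ⟨_, hs⟩ ⟨_, hs'⟩ rfl rfl,
          floorMap_eq φ p t ⟨_, hs'⟩ ⟨_, ht'⟩ h.symm rfl,
          floorMap_eq φ p (s * t) ⟨_, hs⟩ ⟨_, ht'⟩ (dom_mul h) (ran_mul h), blockUnit_mul,
          ← Transversal.conj_mul]
      · rw [if_neg h, floorMap_eq φ p s ⟨_, hs⟩ ⟨_, hs'⟩ rfl rfl,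
          floorMap_eq φ p t ⟨_, ht⟩ ⟨_, ht'⟩ rfl rfl, blockUnit_mul_of_ne]
        exact fun h' => h (congrArg Subtype.val h')
    · have : ran s ≠ dom t := fun h => ht (h ▸ hs')
      rw [if_neg this, floorMap, floorMap, dif_neg ht, mul_zero]
  · rw [floorMap, dif_neg hs, zero_mul]
    split_ifs with h
    · rw [floorMap, dif_neg]
      rwa [dom_mul h]
    · rfl

open Classical in
/-- The representation `φ*` of `S` induced by a representation `φ` of `G_e`. It is given by
`φ*(⌊t⌋) = φ (p_f t p_g⁻¹) E_{f,g}` for `t` in the `𝒟`-class of `e` with `dom t = f`,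
`ran t = g`, by `φ*(⌊t⌋) = 0` for all other `t`, and by `s = ∑_{t ≤ s} ⌊t⌋`. -/
noncomputable def induced [Fintype S] (φ : Representation K (MaxSubgroup e) W)
    (p : Transversal e) : SemigroupRep K S ({f : Idem S // Isomorphic e f} → W) where
  toFun s := ∑ t : S with NatLE t s, floorMap φ p t
  map_mul' s s' := by
    rw [Finset.sum_mul_sum, ← Finset.sum_product']
    simp only [floorMap_mul]
    rw [← Finset.sum_filter]
    symm
    refine Finset.sum_bij' (fun x _ => x.1 * x.2)
      (fun u _ => ((dom u).1 * s, s' * (ran u).1)) ?_ ?_ ?_ ?_ ?_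
    · rintro ⟨t, t'⟩ hx
      simp only [Finset.mem_filter, Finset.mem_product, Finset.mem_univ, true_and] at hx ⊢
      exact hx.1.1.mul hx.1.2
    · intro u hu
      simp only [Finset.mem_filter, Finset.mem_product, Finset.mem_univ, true_and] at hu ⊢
      exact ⟨⟨⟨dom u, rfl⟩, natLE_mul_idem s' (ran u)⟩, ran_dom_mul_eq hu⟩
    · rintro ⟨t, t'⟩ hx
      simp only [Finset.mem_filter, Finset.mem_product, Finset.mem_univ, true_and] at hx ⊢
      rw [dom_mul hx.2, ran_mul hx.2, hx.1.1.eq_dom_mul, hx.1.2.eq_mul_ran]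
    · intro u hu
      simp only [Finset.mem_filter, Finset.mem_univ, true_and] at hu
      calc (dom u).1 * s * (s' * (ran u).1) = ((dom u).1 * (s * s')) * (ran u).1 := by
            simp only [mul_assoc]
        _ = u := by rw [hu.eq_dom_mul, mul_ran_self]
    · intro x _
      rfl

end Induced

section Pairing

variable {K : Type*} [Field K]

/-- The bilinear form `(ψ, α)_G = |G|⁻¹ ∑_{g ∈ G} ψ(g⁻¹) α(g)`. -/
noncomputable def pairing {G : Type*} [Group G] [Fintype G] (ψ α : G → K) : K :=
  1 / (Fintype.card G : K) * ∑ g : G, ψ g⁻¹ * α g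

variable {S : Type*} [InverseSemigroup S]

/-- The restriction to `G_e` of the function `θ_f`, where `θ_f(s) = θ(fs)`. -/
def translate (θ : S → K) (f e : Idem S) : MaxSubgroup e → K := fun g => θ (f.val * g.val)

open Classical in
/-- `(χ, θ)_S = ∑_{f ≤ e} (χ, θ_f)_{G_e} μ(f, e)`. -/
noncomputable def intertwiningNumber [Fintype S] {e : Idem S} (χ : MaxSubgroup e → K)
    (θ : S → K) : K :=
  ∑ f : Idem S with f ≤ e, pairing χ (translate θ f e) * moebius K f e

end Pairing

end InverseSemigroup

/-! A representation of `S` is a representation of a groupoid in disguise. Put `⌊s⌋ = ∑_{u ≤ s} μ(u,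
s) ρ(u)` (`floorOp`). Möbius inversion gives `ρ(s) = ∑_{t ≤ s} ⌊t⌋` (`sum_floorOp`), and `⌊s⌋⌊t⌋` is
`⌊st⌋` if `ran s = dom t` and `0` otherwise (`floorOp_mul`). For `φ*` the operators `⌊t⌋` are single
blocks (`floorOp_induced`), so an invariant subspace is closed under all of them, and irreducibility
of `φ` passes to `φ*`.

Complete reducibility is Maschke's argument with an average over the groupoid in place of a group
(`exists_isCompl_of_isInvariant`).

For the formula, linearity of the trace turns `(χ, θ)_S` into the pairing of `χ` with `g ↦ tr ⌊g⌋`,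
the character of `G_e` on `⌊e⌋V`. Hence `(χ, θ)_S = dim Hom_{G_e}(W, ⌊e⌋V)`
(`intertwiningNumber_eq_finrank`). This is additive over a decomposition of `ρ`, so irreducible `σ`
suffice. A nonzero `G_e`-map `W → ⌊e⌋V` extends to a nonzero `S`-map from `φ*` to `σ`, an
isomorphism by Schur's lemma; so summands not equivalent to `φ*` contribute `0`. For `φ*` itself `tr
⌊g⌋ = χ(g)`, and the contribution is `dim End_{G_e}(W) = d`. -/

namespace InverseSemigroup

/-! ### The Möbius function of the idempotents. -/

section Moebius

variable {K S : Type*} [Field K] [InverseSemigroup S] [Fintype S]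

theorem moebius_self (f : Idem S) : moebius K f f = 1 := by
  simp [moebius]

open Classical in
theorem sum_moebius (h f : Idem S) :
    ∑ g : Idem S with h ≤ g ∧ g ≤ f, moebius K h g = if h = f then 1 else 0 := by
  let _ : LocallyFiniteOrder (Idem S) := Fintype.toLocallyFiniteOrder
  rw [← IncidenceAlgebra.sum_Icc_mu_right (𝕜 := K) h f]
  refine Finset.sum_congr ?_ fun _ _ => rfl
  ext g
  simp

end Moebius

/-! ### Idempotents as a meet semilattice, and conjugation by elements of `S`. -/

section Order

variable {S : Type*} [InverseSemigroup S]

theorem Idem.comm (e f : Idem S) : e.1 * f.1 = f.1 * e.1 := idem_comm e.idem f.idem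

theorem Idem.le_iff {e f : Idem S} : e ≤ f ↔ e.1 * f.1 = e.1 :=
  ⟨fun h => h.1, fun h => ⟨h, by rw [Idem.comm, h]⟩⟩

/-- The product of two idempotents, which is their meet. -/
def Idem.meet (e f : Idem S) : Idem S := ⟨e.1 * f.1, idem_mul_idem e.idem f.idem⟩

theorem Idem.le_meet_iff {e f g : Idem S} : g ≤ e.meet f ↔ g ≤ e ∧ g ≤ f := by
  simp only [Idem.le_iff, Idem.meet]
  constructor
  · intro h
    constructor
    · conv_lhs => rw [← h]
      rw [mul_assoc, mul_assoc, f.comm e, ← mul_assoc e.1, e.idem, h]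
    · conv_lhs => rw [← h]
      rw [mul_assoc, mul_assoc, f.idem, h]
  · rintro ⟨h1, h2⟩
    rw [← mul_assoc, h1, h2]

/-- The conjugate idempotent `s f s⁻¹`. -/
def Idem.conj (s : S) (f : Idem S) : Idem S := ⟨s * f.1 * s⁻¹, by
  calc s * f.1 * s⁻¹ * (s * f.1 * s⁻¹) = s * (f.1 * (s⁻¹ * s)) * (f.1 * s⁻¹) := by
        simp only [mul_assoc]
    _ = (s * s⁻¹ * s) * (f.1 * f.1) * s⁻¹ := by
        rw [idem_comm f.idem (inv_mul_idem s)]; simp only [mul_assoc]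
    _ = s * f.1 * s⁻¹ := by rw [mul_inv_mul, f.idem]⟩

theorem Idem.conj_mul_self (s : S) (f : Idem S) : (Idem.conj s f).1 * s = s * f.1 := by
  change s * f.1 * s⁻¹ * s = s * f.1
  rw [mul_assoc, mul_assoc, f.comm ⟨_, inv_mul_idem s⟩, ← mul_assoc, mul_inv_mul']

theorem Idem.mul_conj_inv (s : S) (f : Idem S) : s * (Idem.conj s⁻¹ f).1 = f.1 * s := by
  change s * (s⁻¹ * f.1 * (s⁻¹)⁻¹) = f.1 * s
  rw [inv_involutive]
  calc s * (s⁻¹ * f.1 * s) = ((s * s⁻¹) * f.1) * s := by simp only [mul_assoc]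
    _ = f.1 * (s * s⁻¹ * s) := by
        rw [idem_comm (mul_inv_idem s) f.idem]; simp only [mul_assoc]
    _ = f.1 * s := by rw [mul_inv_mul]

/-- Used contrapositively in `floorOp_eq`: an idempotent strictly below `dom s`, once moved across
`s`, does not lie above `ran s`. -/
theorem dom_le_of_ran_le_conj {s : S} {f : Idem S} (h : ran s ≤ Idem.conj s⁻¹ f) : dom s ≤ f := by
  rw [Idem.le_iff] at h ⊢
  have h1 : f.1 * s = s := by
    rw [← Idem.mul_conj_inv]
    calc s * (Idem.conj s⁻¹ f).1 = s * ((ran s).1 * (Idem.conj s⁻¹ f).1) := by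
          rw [← mul_assoc, mul_ran_self]
      _ = s := by rw [h, mul_ran_self]
  rw [Idem.comm]
  change f.1 * (s * s⁻¹) = s * s⁻¹
  rw [← mul_assoc, h1]

theorem ran_le_of_dom_le_conj {s : S} {f : Idem S} (h : dom s ≤ Idem.conj s f) : ran s ≤ f := by
  rw [← dom_inv]
  refine dom_le_of_ran_le_conj ?_
  rwa [ran_inv, inv_involutive]

theorem ran_idem (e : Idem S) : ran e.1 = e := Idem.ext (by
  change e.1⁻¹ * e.1 = e.1
  rw [idem_inv e.idem, e.idem])

theorem dom_idem (e : Idem S) : dom e.1 = e := Idem.ext (by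
  change e.1 * e.1⁻¹ = e.1
  rw [idem_inv e.idem, e.idem])

theorem dom_idem_mul {e : Idem S} {s : S} (h : e ≤ dom s) : dom (e.1 * s) = e := by
  refine Idem.ext ?_
  change e.1 * s * (e.1 * s)⁻¹ = e.1
  rw [Idem.le_iff] at h
  change e.1 * (s * s⁻¹) = e.1 at h
  calc e.1 * s * (e.1 * s)⁻¹ = (e.1 * (s * s⁻¹)) * e.1 := by
        rw [mul_inv_rev', idem_inv e.idem]; simp only [mul_assoc]
    _ = e.1 := by rw [h, e.idem]

theorem NatLE.dom_le {t s : S} (h : NatLE t s) : dom t ≤ dom s := by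
  have h1 : (dom s).1 * t = t := by
    conv_lhs => rw [← h.eq_dom_mul]
    rw [← mul_assoc, Idem.comm, mul_assoc, dom_mul_self, h.eq_dom_mul]
  rw [Idem.le_iff, Idem.comm]
  change (dom s).1 * (t * t⁻¹) = t * t⁻¹
  rw [← mul_assoc, h1]

theorem natLE_idem_mul (e : Idem S) (s : S) : NatLE (e.1 * s) s := ⟨e, rfl⟩

end Order

/-! ### The groupoid operators `⌊s⌋` of a representation. -/

section Floor

variable {K S V : Type*} [Field K] [InverseSemigroup S] [Fintype S] [AddCommGroup V] [Module K V]

open Classical in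
/-- The operator `∑_{g ≤ f} μ(g, f) ρ(g)` attached to an idempotent `f`. -/
noncomputable def idemPart (ρ : SemigroupRep K S V) (f : Idem S) : Module.End K V :=
  ∑ g : Idem S with g ≤ f, moebius K g f • ρ g.1

/-- The operator `∑_{u ≤ s} μ(u, s) ρ(u)` attached to `s`. -/
noncomputable def floorOp (ρ : SemigroupRep K S V) (s : S) : Module.End K V :=
  idemPart ρ (dom s) * ρ s

variable (ρ : SemigroupRep K S V)

-- Möbius inversion. With `idemPart_eq_sub` it yields a recursion that replaces explicit values of
-- `μ` in later inductions.
open Classical in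
theorem sum_idemPart (f : Idem S) : ∑ g : Idem S with g ≤ f, idemPart ρ g = ρ f.1 := by
  simp only [idemPart]
  rw [Finset.sum_comm' (t' := Finset.univ.filter (· ≤ f))
    (s' := fun h => Finset.univ.filter fun g => h ≤ g ∧ g ≤ f)]
  · simp only [← Finset.sum_smul, sum_moebius, ite_smul, one_smul, zero_smul]
    rw [Finset.sum_ite_eq', if_pos (by simp)]
  · intro g h
    simp only [Finset.mem_filter, Finset.mem_univ, true_and]
    exact ⟨fun ⟨h1, h2⟩ => ⟨⟨h2, h1⟩, h2.trans h1⟩, fun ⟨⟨h1, h2⟩, _⟩ => ⟨h2, h1⟩⟩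

open Classical in
theorem idemPart_eq_sub (f : Idem S) :
    idemPart ρ f = ρ f.1 - ∑ g : Idem S with g < f, idemPart ρ g := by
  rw [← sum_idemPart, eq_sub_iff_add_eq]
  have : (Finset.univ.filter fun g : Idem S => g ≤ f)
      = insert f (Finset.univ.filter fun g : Idem S => g < f) := by
    ext g
    simp [le_iff_eq_or_lt]
  rw [this, Finset.sum_insert (by simp)]

-- The operators `⌊f⌋` behave as simultaneous eigenprojections: `ρ(h)` is the sum of those with `f ≤
-- h`. This gives their orthogonality.
open Classical in
theorem map_mul_idemPart (h f : Idem S) :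
    ρ h.1 * idemPart ρ f = if f ≤ h then idemPart ρ f else 0 := by
  induction f using WellFoundedLT.induction with
  | ind f ih =>
    rw [idemPart_eq_sub, mul_sub, ← map_mul, Finset.mul_sum]
    rw [Finset.sum_congr rfl fun g hg => ih g (Finset.mem_filter.1 hg).2, ← Finset.sum_filter,
      Finset.filter_filter]
    split_ifs with hf
    · rw [hf.2]
      congr 1
      refine Finset.sum_congr ?_ fun _ _ => rfl
      ext g
      simp only [Finset.mem_filter, Finset.mem_univ, true_and, and_iff_left_iff_imp]
      exact fun hg => hg.le.trans hf
    -- As `f ≤ h` fails, the `g` below the meet `hf` are exactly the `g < f` with `g ≤ h`.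
    · rw [sub_eq_zero]
      change ρ (h.meet f).1 = _
      rw [← sum_idemPart]
      refine Finset.sum_congr ?_ fun _ _ => rfl
      ext g
      simp only [Finset.mem_filter, Finset.mem_univ, true_and, Idem.le_meet_iff]
      exact ⟨fun hg => ⟨lt_of_le_of_ne hg.2 (by rintro rfl; exact hf hg.1), hg.1⟩,
        fun hg => ⟨hg.2, hg.1.le⟩⟩

theorem idemPart_commute (h f : Idem S) : idemPart ρ f * ρ h.1 = ρ h.1 * idemPart ρ f := by
  simp only [idemPart, Finset.sum_mul, Finset.mul_sum, smul_mul_assoc, mul_smul_comm, ← map_mul]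
  exact Finset.sum_congr rfl fun g _ => by rw [g.comm h]

/-- Only the term `g = f` of the Möbius sum survives, with coefficient `μ(f, f) = 1`. -/
theorem idemPart_mul_eq_self {f : Idem S} {x : Module.End K V} (h : ρ f.1 * x = x)
    (h' : ∀ g, g < f → ρ g.1 * x = 0) : idemPart ρ f * x = x := by
  classical
  rw [idemPart, Finset.sum_mul, Finset.sum_eq_single f]
  · rw [smul_mul_assoc, h, moebius_self, one_smul]
  · intro g hg hgf
    rw [smul_mul_assoc, h' g (lt_of_le_of_ne (Finset.mem_filter.1 hg).2 hgf), smul_zero]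
  · simp

theorem mul_idemPart_eq_self {f : Idem S} {x : Module.End K V} (h : x * ρ f.1 = x)
    (h' : ∀ g, g < f → x * ρ g.1 = 0) : x * idemPart ρ f = x := by
  classical
  rw [idemPart, Finset.mul_sum, Finset.sum_eq_single f]
  · rw [mul_smul_comm, h, moebius_self, one_smul]
  · intro g hg hgf
    rw [mul_smul_comm, h' g (lt_of_le_of_ne (Finset.mem_filter.1 hg).2 hgf), smul_zero]
  · simp

theorem idemPart_mul_self (f : Idem S) : idemPart ρ f * idemPart ρ f = idemPart ρ f :=
  idemPart_mul_eq_self ρ (by rw [map_mul_idemPart, if_pos le_rfl])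
    fun g hg => by rw [map_mul_idemPart, if_neg hg.not_ge]

theorem idemPart_mul_of_ne {f g : Idem S} (h : f ≠ g) : idemPart ρ f * idemPart ρ g = 0 := by
  by_cases hfg : f ≤ g
  · have hgf : ¬ g ≤ f := fun h' => h (le_antisymm hfg h')
    have h1 : idemPart ρ f * ρ f.1 = idemPart ρ f := by
      rw [idemPart_commute, map_mul_idemPart, if_pos le_rfl]
    rw [← h1, mul_assoc, map_mul_idemPart, if_neg hgf, mul_zero]
  · have h1 : ρ g.1 * idemPart ρ g = idemPart ρ g := by
      rw [map_mul_idemPart, if_pos le_rfl]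
    rw [← h1, ← mul_assoc, idemPart_commute, map_mul_idemPart, if_neg hfg, zero_mul]

/-- Both sides equal `⌊dom s⌋ ρ(s) ⌊ran s⌋`. For `g < dom s` one has `ρ(g)ρ(s) = ρ(s)ρ(s⁻¹gs)`, and
`⌊ran s⌋` kills this because `s⁻¹gs` is not above `ran s`; the other side is symmetric. -/
theorem floorOp_eq (s : S) : floorOp ρ s = ρ s * idemPart ρ (ran s) := by
  have h1 : idemPart ρ (dom s) * (ρ s * idemPart ρ (ran s)) = ρ s * idemPart ρ (ran s) := by
    refine idemPart_mul_eq_self ρ ?_ fun g hg => ?_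
    · rw [← mul_assoc, ← map_mul, dom_mul_self]
    · rw [← mul_assoc, ← map_mul, ← Idem.mul_conj_inv, map_mul, mul_assoc, map_mul_idemPart,
        if_neg fun h => hg.not_ge (dom_le_of_ran_le_conj h), mul_zero]
  have h2 : idemPart ρ (dom s) * ρ s * idemPart ρ (ran s) = idemPart ρ (dom s) * ρ s := by
    refine mul_idemPart_eq_self ρ ?_ fun g hg => ?_
    · rw [mul_assoc, ← map_mul, mul_ran_self]
    · rw [mul_assoc, ← map_mul, ← Idem.conj_mul_self, map_mul, ← mul_assoc, idemPart_commute,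
        map_mul_idemPart, if_neg fun h => hg.not_ge (ran_le_of_dom_le_conj h), zero_mul]
  rw [floorOp, ← h1, ← mul_assoc, h2]

theorem floorOp_idem (f : Idem S) : floorOp ρ f.1 = idemPart ρ f := by
  rw [floorOp, dom_idem, idemPart_commute, map_mul_idemPart, if_pos le_rfl]

-- Writing the first factor with `⌊ran s⌋` on its right and the second with `⌊dom t⌋` on its left
-- reduces the product to orthogonality of these idempotents.
open Classical in
theorem floorOp_mul (s t : S) :
    floorOp ρ s * floorOp ρ t = if ran s = dom t then floorOp ρ (s * t) else 0 := by
  rw [floorOp_eq, floorOp, mul_assoc, ← mul_assoc (idemPart ρ (ran s))]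
  split_ifs with h
  · rw [h, idemPart_mul_self, ← mul_assoc, ← h, ← floorOp_eq, floorOp, floorOp, dom_mul h,
      map_mul, mul_assoc]
  · rw [idemPart_mul_of_ne ρ h, zero_mul, mul_zero]

-- An element below `s` is determined by its domain, which can be any idempotent below `dom s`.
open Classical in
theorem sum_natLE {M : Type*} [AddCommMonoid M] (F : S → M) (s : S) :
    ∑ t : S with NatLE t s, F t = ∑ f : Idem S with f ≤ dom s, F (f.1 * s) := by
  refine Finset.sum_bij' (fun t _ => dom t) (fun f _ => f.1 * s) ?_ ?_ ?_ ?_ ?_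
  · intro t ht
    simp only [Finset.mem_filter, Finset.mem_univ, true_and] at ht ⊢
    exact ht.dom_le
  · intro f _
    simp only [Finset.mem_filter, Finset.mem_univ, true_and]
    exact natLE_idem_mul f s
  · intro t ht
    simp only [Finset.mem_filter, Finset.mem_univ, true_and] at ht
    exact ht.eq_dom_mul
  · intro f hf
    simp only [Finset.mem_filter, Finset.mem_univ, true_and] at hf
    exact dom_idem_mul hf
  · intro t ht
    simp only [Finset.mem_filter, Finset.mem_univ, true_and] at ht
    rw [ht.eq_dom_mul]

open Classical in
theorem sum_floorOp (s : S) : ∑ t : S with NatLE t s, floorOp ρ t = ρ s := by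
  rw [sum_natLE]
  conv_rhs => rw [← dom_mul_self s, map_mul, ← sum_idemPart, Finset.sum_mul]
  refine Finset.sum_congr rfl fun f hf => ?_
  rw [floorOp, dom_idem_mul (Finset.mem_filter.1 hf).2, map_mul, ← mul_assoc, idemPart_commute,
    map_mul_idemPart, if_pos le_rfl]

theorem floorOp_mem_of_isInvariant {U : Submodule K V} (hU : IsInvariant ρ U) (s : S) {v : V}
    (hv : v ∈ U) : floorOp ρ s v ∈ U := by
  rw [floorOp, idemPart, Module.End.mul_apply, LinearMap.sum_apply]
  exact U.sum_mem fun g _ => U.smul_mem _ (hU _ _ (hU _ _ hv))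

end Floor

/-! ### Irreducibility of the induced representation. -/

section InducedIrreducible

variable {K S W : Type*} [Field K] [InverseSemigroup S] [AddCommGroup W] [Module K W] {e : Idem S}

theorem isomorphic_refl (e : Idem S) : Isomorphic e e := ⟨e.1, dom_idem e, ran_idem e⟩

theorem Transversal.inv_mul_apply (p : Transversal e) (f : {f : Idem S // Isomorphic e f}) :
    (p.toFun f)⁻¹ * p.toFun f = f.1.1 := congrArg Idem.val (p.ran_eq f)

theorem Transversal.apply_mul_inv (p : Transversal e) (f : {f : Idem S // Isomorphic e f}) :
    p.toFun f * (p.toFun f)⁻¹ = e.1 := congrArg Idem.val (p.dom_eq f)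

variable (φ : Representation K (MaxSubgroup e) W) (p : Transversal e)

open Classical in
theorem blockUnit_apply (f g : {f : Idem S // Isomorphic e f}) (x : MaxSubgroup e)
    (v : {f : Idem S // Isomorphic e f} → W) :
    blockUnit φ f g x v = Pi.single f (φ x (v g)) := rfl

/-- The idempotent `e`, as an index of the direct sum carrying the induced representation. -/
def baseIndex (e : Idem S) : {f : Idem S // Isomorphic e f} := ⟨e, isomorphic_refl e⟩

open Classical in
theorem floorMap_apply (f g : {f : Idem S // Isomorphic e f}) (s : S) (hf : dom s = f.1)
    (hg : ran s = g.1) (v : {f : Idem S // Isomorphic e f} → W) :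
    floorMap φ p s v = Pi.single f (φ (p.conj f g s hf hg) (v g)) := by
  rw [floorMap_eq φ p s f g hf hg, blockUnit_apply]

/-- For `x ∈ G_e` the element `p_f⁻¹ x p_g`, whose block is `φ x` in row `f` and
column `g`. -/
theorem exists_conj_eq (f g : {f : Idem S // Isomorphic e f}) (x : MaxSubgroup e) :
    ∃ s, ∃ (hf : dom s = f.1) (hg : ran s = g.1), p.conj f g s hf hg = x := by
  have h1 : ran (p.toFun f)⁻¹ = dom x.val := by rw [ran_inv, p.dom_eq, x.dom_eq]
  have h2 : ran ((p.toFun f)⁻¹ * x.val) = dom (p.toFun g) := by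
    rw [ran_mul h1, x.ran_eq, p.dom_eq]
  refine ⟨(p.toFun f)⁻¹ * x.val * p.toFun g, ?_, ?_, ?_⟩
  · rw [dom_mul h2, dom_mul h1, dom_inv, p.ran_eq]
  · rw [ran_mul h2, p.ran_eq]
  · refine MaxSubgroup.ext ?_
    change p.toFun f * ((p.toFun f)⁻¹ * x.val * p.toFun g) * (p.toFun g)⁻¹ = x.val
    calc p.toFun f * ((p.toFun f)⁻¹ * x.val * p.toFun g) * (p.toFun g)⁻¹
        = (p.toFun f * (p.toFun f)⁻¹) * x.val * (p.toFun g * (p.toFun g)⁻¹) := by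
          simp only [mul_assoc]
      _ = x.val := by
          rw [Transversal.apply_mul_inv, Transversal.apply_mul_inv]
          exact congrArg MaxSubgroup.val (show 1 * x * 1 = x by rw [one_mul, mul_one])

variable [Fintype S]

/-- Both families satisfy the recursion of `idemPart_eq_sub`, so they agree by induction on `f`. -/
theorem idemPart_induced (f : Idem S) : idemPart (induced φ p) f = floorMap φ p f.1 := by
  classical
  induction f using WellFoundedLT.induction with
  | ind f ih =>
    have h : induced φ p f.1 = ∑ g : Idem S with g ≤ f, floorMap φ p g.1 := by
      change ∑ t : S with NatLE t f.1, floorMap φ p t = _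
      rw [sum_natLE, dom_idem]
      exact Finset.sum_congr rfl fun g hg => by rw [(Finset.mem_filter.1 hg).2.1]
    have h' : (Finset.univ.filter fun g : Idem S => g ≤ f)
        = insert f (Finset.univ.filter fun g : Idem S => g < f) := by
      ext g
      simp [le_iff_eq_or_lt]
    rw [idemPart_eq_sub, h, h', Finset.sum_insert (by simp),
      Finset.sum_congr rfl fun g hg => ih g (Finset.mem_filter.1 hg).2, add_sub_cancel_right]

theorem floorOp_induced (s : S) : floorOp (induced φ p) s = floorMap φ p s := by
  classical
  rw [floorOp, idemPart_induced]
  change floorMap φ p (dom s).1 * ∑ t : S with NatLE t s, floorMap φ p t = _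
  rw [Finset.mul_sum, Finset.sum_eq_single s]
  · rw [floorMap_mul, if_pos (ran_idem _), dom_mul_self]
  · intro t ht hts
    rw [floorMap_mul, if_neg]
    rw [ran_idem]
    intro h
    apply hts
    rw [← (Finset.mem_filter.1 ht).2.eq_dom_mul, ← h, dom_mul_self]
  · intro h
    exact absurd (Finset.mem_filter.2 ⟨Finset.mem_univ _, ⟨dom s, (dom_mul_self s).symm⟩⟩) h

-- Invariant subspaces are stable under every block: a coordinate can be isolated, twisted by `G_e`
-- and moved to any position.
open Classical in
theorem single_mem_of_isInvariant {U : Submodule K ({f : Idem S // Isomorphic e f} → W)}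
    (hU : IsInvariant (induced φ p) U) {v : {f : Idem S // Isomorphic e f} → W} (hv : v ∈ U)
    (f g : {f : Idem S // Isomorphic e f}) (x : MaxSubgroup e) :
    (Pi.single f (φ x (v g)) : {f : Idem S // Isomorphic e f} → W) ∈ U := by
  obtain ⟨s, hf, hg, rfl⟩ := exists_conj_eq p f g x
  rw [← floorMap_apply φ p f g s hf hg, ← floorOp_induced]
  exact floorOp_mem_of_isInvariant _ hU s hv

theorem induced_isIrreducible (hφ : φ.IsIrreducible) : IsIrreducible (induced φ p) := by
  classical
  have hbt : (⊥ : Subrepresentation φ) ≠ ⊤ := bot_ne_top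
  have hW : Nontrivial W := by
    by_contra hW
    rw [not_nontrivial_iff_subsingleton] at hW
    exact hbt (SetLike.ext fun x => by
      rw [Subsingleton.elim x 0]
      exact iff_of_true (zero_mem (⊥ : Submodule K W)) (zero_mem (⊤ : Submodule K W)))
  have : Nonempty {f : Idem S // Isomorphic e f} := ⟨baseIndex e⟩
  refine ⟨inferInstance, fun U hU => ?_⟩
  rw [or_iff_not_imp_left]
  intro hU0
  obtain ⟨v, hv, hv0⟩ := U.ne_bot_iff.1 hU0
  obtain ⟨g, hg⟩ := Function.ne_iff.1 hv0
  -- The vectors whose copy in the block at `e` lies in `U`. It contains the nonzero coordinate `v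
  -- g`, so irreducibility of `φ` makes it all of `W`.
  let X : Subrepresentation φ :=
    { toSubmodule := U.comap (LinearMap.single K (fun _ => W) (baseIndex e))
      apply_mem_toSubmodule := fun x w hw => by
        have := single_mem_of_isInvariant φ p hU hw (baseIndex e) (baseIndex e) x
        simpa using this }
  have hX : v g ∈ X.toSubmodule := by
    have := single_mem_of_isInvariant φ p hU hv (baseIndex e) g 1
    simpa [X] using this
  have hXt : X = ⊤ := (hφ.eq_bot_or_eq_top X).resolve_left fun h => hg (by
    rw [h] at hX
    exact (Submodule.mem_bot K).1 hX)
  rw [eq_top_iff]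
  intro u _
  rw [← Finset.univ_sum_single u]
  refine U.sum_mem fun f _ => ?_
  have h1 : u f ∈ X.toSubmodule := by
    rw [hXt]
    exact Submodule.mem_top
  have := single_mem_of_isInvariant φ p hU h1 f (baseIndex e) 1
  simpa using this

end InducedIrreducible

/-! ### Maschke's theorem by averaging over the groupoid. -/

section Semisimple

variable {K S V : Type*} [Field K] [InverseSemigroup S]
  [AddCommGroup V] [Module K V]

theorem inv_mul_cancel_of_dom {s t : S} (h : dom t = ran s) : s⁻¹ * (s * t) = t := by
  rw [← mul_assoc]
  change (ran s).1 * t = t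
  rw [← h, dom_mul_self]

theorem mul_inv_cancel_of_dom {s t : S} (h : dom t = dom s) : s * (s⁻¹ * t) = t := by
  rw [← mul_assoc]
  change (dom s).1 * t = t
  rw [← h, dom_mul_self]

variable [Fintype S]

open Classical in
/-- The number of `t ∈ S` with `dom t = f`. -/
noncomputable def domCard (f : Idem S) : ℕ := (Finset.univ.filter fun t : S => dom t = f).card

-- Left translation by `s` is a bijection with inverse translation by `s⁻¹`: the groupoid form of
-- translation invariance.
open Classical in
theorem sum_dom_eq_ran {M : Type*} [AddCommMonoid M] (F : S → M) (s : S) :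
    ∑ t : S with dom t = ran s, F (s * t) = ∑ t : S with dom t = dom s, F t := by
  refine Finset.sum_bij' (fun t _ => s * t) (fun t _ => s⁻¹ * t) ?_ ?_ ?_ ?_ ?_
  · intro t ht
    simp only [Finset.mem_filter, Finset.mem_univ, true_and] at ht ⊢
    exact dom_mul ht.symm
  · intro t ht
    simp only [Finset.mem_filter, Finset.mem_univ, true_and] at ht ⊢
    rw [dom_mul (by rw [ran_inv, ht]), dom_inv]
  · intro t ht
    exact inv_mul_cancel_of_dom (Finset.mem_filter.1 ht).2
  · intro t ht
    exact mul_inv_cancel_of_dom (Finset.mem_filter.1 ht).2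
  · intro t _
    rfl

theorem domCard_ran (s : S) : domCard (ran s) = domCard (dom s) := by
  classical
  rw [domCard, domCard, Finset.card_eq_sum_ones, Finset.card_eq_sum_ones]
  exact sum_dom_eq_ran (fun _ => 1) s

theorem domCard_pos (f : Idem S) : 0 < domCard f := by
  classical
  exact Finset.card_pos.2 ⟨f.1, by simp [dom_idem]⟩

variable (ρ : SemigroupRep K S V)

/-- The groupoid average `∑_t n(dom t)⁻¹ ⌊t⌋ π ⌊t⁻¹⌋`. -/
noncomputable def average (π : Module.End K V) : Module.End K V :=
  ∑ t : S, (domCard (dom t) : K)⁻¹ • (floorOp ρ t * π * floorOp ρ t⁻¹)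

/-- The sum of all `⌊f⌋`, the identity of the image of the semigroup algebra. -/
noncomputable def unitOp : Module.End K V := ∑ f : Idem S, idemPart ρ f

theorem floorOp_mul_unitOp (s : S) : floorOp ρ s * unitOp ρ = floorOp ρ s := by
  classical
  rw [unitOp, Finset.mul_sum, Finset.sum_eq_single (ran s)]
  · rw [floorOp_eq, mul_assoc, idemPart_mul_self]
  · intro f _ hf
    rw [floorOp_eq, mul_assoc, idemPart_mul_of_ne ρ hf.symm, mul_zero]
  · simp

theorem unitOp_mul_floorOp (s : S) : unitOp ρ * floorOp ρ s = floorOp ρ s := by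
  classical
  rw [unitOp, Finset.sum_mul, Finset.sum_eq_single (dom s)]
  · rw [floorOp, ← mul_assoc, idemPart_mul_self]
  · intro f _ hf
    rw [floorOp, ← mul_assoc, idemPart_mul_of_ne ρ hf, zero_mul]
  · simp

theorem unitOp_isIdempotentElem : IsIdempotentElem (unitOp ρ) := by
  change (∑ f : Idem S, idemPart ρ f) * unitOp ρ = ∑ f : Idem S, idemPart ρ f
  rw [Finset.sum_mul]
  exact Finset.sum_congr rfl fun f _ => by rw [← floorOp_idem, floorOp_mul_unitOp]

/-- Substitute `st` for `t`. The weights match because `domCard` takes the same value at `dom s` and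
`ran s`. -/
theorem average_commute (π : Module.End K V) (s : S) :
    floorOp ρ s * average ρ π = average ρ π * floorOp ρ s := by
  classical
  have h1 : floorOp ρ s * average ρ π = ∑ t : S with dom t = ran s,
      (domCard (dom (s * t)) : K)⁻¹ • (floorOp ρ (s * t) * π * floorOp ρ ((s * t)⁻¹ * s)) := by
    rw [average, Finset.mul_sum, Finset.sum_filter]
    refine Finset.sum_congr rfl fun t _ => ?_
    rw [mul_smul_comm, ← mul_assoc, ← mul_assoc, floorOp_mul]
    split_ifs with h h' h'
    · rw [mul_inv_rev', mul_assoc t⁻¹]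
      change _ = _ • (_ * _ * floorOp ρ (t⁻¹ * (ran s).1))
      rw [dom_mul h, ← domCard_ran s, h, ← ran_inv t, mul_ran_self]
    · exact absurd h.symm h'
    · exact absurd h'.symm h
    · simp
  have h2 : average ρ π * floorOp ρ s = ∑ t : S with dom t = dom s,
      (domCard (dom t) : K)⁻¹ • (floorOp ρ t * π * floorOp ρ (t⁻¹ * s)) := by
    rw [average, Finset.sum_mul, Finset.sum_filter]
    refine Finset.sum_congr rfl fun t _ => ?_
    rw [smul_mul_assoc, mul_assoc, floorOp_mul, ran_inv]
    split_ifs with h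
    · rfl
    · simp
  rw [h1, h2]
  exact sum_dom_eq_ran (fun t => (domCard (dom t) : K)⁻¹ •
    (floorOp ρ t * π * floorOp ρ (t⁻¹ * s))) s

theorem commute_of_floorOp {x : Module.End K V} (h : ∀ t, floorOp ρ t * x = x * floorOp ρ t)
    (s : S) : ρ s * x = x * ρ s := by
  classical
  rw [← sum_floorOp, Finset.sum_mul, Finset.mul_sum]
  exact Finset.sum_congr rfl fun t _ => h t

variable [CharZero K]

/-- Each `t` with `dom t = f` contributes `n(f)⁻¹ ⌊f⌋ v`, and there are `n(f)` such `t`. -/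
theorem average_apply_of_forall {π : Module.End K V} {v : V}
    (h : ∀ t : S, π (floorOp ρ t v) = floorOp ρ t v) : average ρ π v = unitOp ρ v := by
  classical
  have h1 : ∀ t : S, (floorOp ρ t * π * floorOp ρ t⁻¹) v = idemPart ρ (dom t) v := fun t => by
    rw [Module.End.mul_apply, Module.End.mul_apply, h, ← Module.End.mul_apply, floorOp_mul,
      if_pos (dom_inv t).symm, ← floorOp_idem]
    rfl
  simp only [average, unitOp, LinearMap.sum_apply, LinearMap.smul_apply, h1]
  rw [← Finset.sum_fiberwise Finset.univ dom]
  refine Finset.sum_congr rfl fun f _ => ?_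
  rw [Finset.sum_congr rfl fun t ht => by rw [(Finset.mem_filter.1 ht).2], Finset.sum_const]
  change domCard f • _ = _
  rw [← Nat.cast_smul_eq_nsmul K, smul_smul, mul_inv_cancel₀, one_smul]
  exact_mod_cast (domCard_pos f).ne'

theorem exists_isCompl_of_isInvariant {U : Submodule K V} (hU : IsInvariant ρ U) :
    ∃ U', IsInvariant ρ U' ∧ IsCompl U U' := by
  obtain ⟨q, hq⟩ := U.subtype.exists_leftInverse_of_injective U.ker_subtype
  have hqU : ∀ u ∈ U, U.subtype (q u) = u := fun u hu => by
    have := LinearMap.congr_fun hq ⟨u, hu⟩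
    exact congrArg Subtype.val this
  set π : Module.End K V := U.subtype ∘ₗ q with hπ
  have hπm : ∀ v, π v ∈ U := fun v => (q v).2
  -- `ρ` need not be unital. The average projects only inside the image of `unitOp ρ`; on its kernel
  -- every `⌊t⌋` vanishes, so there the compression of `π` commutes trivially and supplies the
  -- missing part.
  set P : Module.End K V := average ρ π + (1 - unitOp ρ) * π * (1 - unitOp ρ) with hP
  have hunit : ∀ v ∈ U, unitOp ρ v ∈ U := fun v hv => by
    rw [unitOp, LinearMap.sum_apply]
    refine U.sum_mem fun f _ => ?_
    rw [← floorOp_idem]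
    exact floorOp_mem_of_isInvariant ρ hU _ hv
  have hPm : ∀ v, P v ∈ U := fun v => by
    rw [hP, LinearMap.add_apply]
    refine U.add_mem ?_ ?_
    · rw [average, LinearMap.sum_apply]
      exact U.sum_mem fun t _ => U.smul_mem _ (floorOp_mem_of_isInvariant ρ hU _ (hπm _))
    · exact U.sub_mem (hπm _) (hunit _ (hπm _))
  have hPid : ∀ u ∈ U, P u = u := fun u hu => by
    rw [hP, LinearMap.add_apply, average_apply_of_forall ρ fun t =>
      hqU _ (floorOp_mem_of_isInvariant ρ hU _ hu)]
    have h1 : (1 - unitOp ρ) u ∈ U := U.sub_mem hu (hunit _ hu)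
    have h2 : π ((1 - unitOp ρ) u) = (1 - unitOp ρ) u := hqU _ h1
    rw [Module.End.mul_apply, Module.End.mul_apply, h2, ← Module.End.mul_apply,
      (unitOp_isIdempotentElem ρ).one_sub.eq]
    simp
  have hPc : ∀ s, ρ s * P = P * ρ s := commute_of_floorOp ρ fun t => by
    have h1 : floorOp ρ t * (1 - unitOp ρ) = 0 := by
      rw [mul_sub, mul_one, floorOp_mul_unitOp, sub_self]
    have h2 : (1 - unitOp ρ) * floorOp ρ t = 0 := by
      rw [sub_mul, one_mul, unitOp_mul_floorOp, sub_self]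
    rw [hP, mul_add, add_mul, average_commute, ← mul_assoc, ← mul_assoc, h1, mul_assoc _ _
      (floorOp ρ t), h2, zero_mul, zero_mul, mul_zero]
  refine ⟨LinearMap.ker P, fun s v hv => ?_, ?_⟩
  · rw [LinearMap.mem_ker] at hv ⊢
    rw [← Module.End.mul_apply, ← hPc, Module.End.mul_apply, hv, map_zero]
  · have := LinearMap.isCompl_of_proj (p := U) (f := P.codRestrict U hPm)
      fun x => Subtype.ext (hPid x x.2)
    rwa [LinearMap.ker_codRestrict] at this

end Semisimple

/-! ### Decomposition into irreducible subrepresentations. -/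

section Decomposition

variable {K S V : Type*} [Field K] [InverseSemigroup S] [Fintype S]
  [AddCommGroup V] [Module K V] [FiniteDimensional K V] [CharZero K]

theorem exists_isInternal_isIrreducible (ρ : SemigroupRep K S V) :
    ∃ (k : ℕ) (U : Fin k → Submodule K V) (hU : ∀ i, IsInvariant ρ (U i)),
      DirectSum.IsInternal U ∧ ∀ i, IsIrreducible (subrep ρ (U i) (hU i)) := by
  -- Over the free algebra on `S` the submodules of `V` are exactly the invariant subspaces, so the
  -- theory of semisimple modules applies.
  let F : FreeAlgebra K S →ₐ[K] Module.End K V := FreeAlgebra.lift K fun s => ρ s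
  let _ : Module (FreeAlgebra K S) V := Module.compHom V F.toRingHom
  have hsmul : ∀ (a : FreeAlgebra K S) (v : V), a • v = F a v := fun _ _ => rfl
  have : IsScalarTower K (FreeAlgebra K S) V := ⟨fun c a v => by
    rw [hsmul, hsmul, map_smul, LinearMap.smul_apply]⟩
  have hι : ∀ (s : S) (v : V), FreeAlgebra.ι K s • v = ρ s v := fun s v => by
    rw [hsmul, FreeAlgebra.lift_ι_apply]
  have hinv : ∀ N : Submodule (FreeAlgebra K S) V, IsInvariant ρ (N.restrictScalars K) :=
    fun N s v hv => by
      rw [← hι]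
      exact N.smul_mem _ hv
  let toSub : ∀ U : Submodule K V, IsInvariant ρ U → Submodule (FreeAlgebra K S) V := fun U hU =>
    { U with
      smul_mem' := fun a => by
        induction a using FreeAlgebra.induction with
        | grade0 r =>
          intro v hv
          rw [algebraMap_smul]
          exact U.smul_mem r hv
        | grade1 s =>
          intro v hv
          rw [hι]
          exact hU s v hv
        | mul a b ha hb =>
          intro v hv
          rw [mul_smul]
          exact ha (hb hv)
        | add a b ha hb =>
          intro v hv
          rw [add_smul]
          exact U.add_mem (ha hv) (hb hv) }
  have hss : IsSemisimpleModule (FreeAlgebra K S) V := by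
    rw [isSemisimpleModule_iff]
    refine ⟨fun N => ?_⟩
    obtain ⟨U', hU', hc⟩ := exists_isCompl_of_isInvariant ρ (hinv N)
    refine ⟨toSub U' hU', isCompl_iff.2 ⟨?_, ?_⟩⟩
    · rw [Submodule.disjoint_def]
      exact fun x hx hx' => Submodule.disjoint_def.1 hc.disjoint x hx hx'
    · rw [codisjoint_iff, eq_top_iff]
      intro x _
      obtain ⟨y, hy, z, hz, rfl⟩ := Submodule.mem_sup.1
        (hc.sup_eq_top.symm ▸ Submodule.mem_top : x ∈ N.restrictScalars K ⊔ U')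
      exact Submodule.add_mem_sup hy hz
  have : IsNoetherian (FreeAlgebra K S) V := isNoetherian_of_tower K inferInstance
  obtain ⟨s, hs, hst, hsimple⟩ :=
    IsSemisimpleModule.exists_sSupIndep_sSup_simples_eq_top (FreeAlgebra K S) V
  have hfin : s.Finite := WellFoundedGT.finite_of_sSupIndep hs
  have := hfin.fintype
  let ε := (Fintype.equivFin s).symm
  have hint : DirectSum.IsInternal fun i => ((ε i : s) : Submodule (FreeAlgebra K S) V) := by
    refine DirectSum.isInternal_submodule_of_iSupIndep_of_iSup_eq_top ?_ ?_
    · exact ((sSupIndep_iff s).1 hs).comp ε.injective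
    · rw [← hst, sSup_eq_iSup', ε.surjective.iSup_comp]
  -- Internality concerns only the underlying additive map, so `hint` carries over to the
  -- `K`-subspaces.
  refine ⟨_, fun i => (ε i : Submodule (FreeAlgebra K S) V).restrictScalars K,
    fun i => hinv _, hint, fun i => ?_⟩
  have hat := isSimpleModule_iff_isAtom.1 (hsimple _ (ε i).2)
  refine ⟨?_, fun U hU => ?_⟩
  · exact (Submodule.nontrivial_iff_ne_bot (p := (ε i : Submodule (FreeAlgebra K S) V))).2 hat.1
  · have hU' : IsInvariant ρ (U.map (Submodule.subtype _)) := by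
      rintro s _ ⟨v, hv, rfl⟩
      exact ⟨_, hU s v hv, rfl⟩
    have hle : toSub _ hU' ≤ (ε i : Submodule (FreeAlgebra K S) V) := by
      rintro _ ⟨v, _, rfl⟩
      exact v.2
    rcases hat.le_iff.1 hle with h | h
    · left
      rw [eq_bot_iff]
      intro v hv
      have : (v : V) ∈ toSub _ hU' := ⟨v, hv, rfl⟩
      rw [h] at this
      exact (Submodule.mem_bot K).2 (Subtype.ext ((Submodule.mem_bot _).1 this))
    · right
      rw [eq_top_iff]
      intro v _
      have : (v : V) ∈ toSub _ hU' := by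
        rw [h]
        exact v.2
      obtain ⟨w, hw, hwv⟩ := this
      rwa [← Subtype.ext hwv]

end Decomposition

/-! ### Equivalence, Schur's lemma and additivity of characters. -/

section Equivalence

variable {K S V V' : Type*} [Field K] [Semigroup S] [AddCommGroup V] [Module K V]
  [AddCommGroup V'] [Module K V']

theorem Equivalent.symm {ρ : SemigroupRep K S V} {σ : SemigroupRep K S V'}
    (h : Equivalent ρ σ) : Equivalent σ ρ := by
  obtain ⟨T, hT⟩ := h
  exact ⟨T.symm, fun s v => by rw [LinearEquiv.symm_apply_eq, hT, LinearEquiv.apply_symm_apply]⟩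

theorem Equivalent.character_eq {ρ : SemigroupRep K S V} {σ : SemigroupRep K S V'}
    (h : Equivalent ρ σ) : character ρ = character σ := by
  obtain ⟨T, hT⟩ := h
  funext s
  have : σ s = T.conj (ρ s) := by
    ext v
    rw [LinearEquiv.conj_apply_apply, hT, LinearEquiv.apply_symm_apply]
  rw [character, character, this, LinearMap.trace_conj']

/-- Schur's lemma. -/
theorem equivalent_of_ne_zero {ρ : SemigroupRep K S V} {σ : SemigroupRep K S V'}
    (hρ : IsIrreducible ρ) (hσ : IsIrreducible σ) (T : V →ₗ[K] V')
    (hT : ∀ s v, T (ρ s v) = σ s (T v)) (h0 : T ≠ 0) : Equivalent ρ σ := by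
  have hker : LinearMap.ker T = ⊥ :=
    (hρ.2 (LinearMap.ker T) fun s v hv => by
      rw [LinearMap.mem_ker] at hv ⊢
      rw [hT, hv, map_zero]).resolve_right fun h => h0 (LinearMap.ker_eq_top.1 h)
  have hrange : LinearMap.range T = ⊤ :=
    (hσ.2 (LinearMap.range T) fun s v hv => by
      obtain ⟨w, rfl⟩ := hv
      exact ⟨ρ s w, hT s w⟩).resolve_left fun h => h0 (LinearMap.range_eq_bot.1 h)
  exact ⟨LinearEquiv.ofBijective T ⟨LinearMap.ker_eq_bot.1 hker, LinearMap.range_eq_top.1 hrange⟩,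
    hT⟩

theorem character_eq_sum [FiniteDimensional K V] (ρ : SemigroupRep K S V) {k : ℕ}
    {U : Fin k → Submodule K V} (hU : ∀ i, IsInvariant ρ (U i)) (h : DirectSum.IsInternal U) :
    character ρ = fun s => ∑ i, character (subrep ρ (U i) (hU i)) s := by
  funext s
  exact LinearMap.trace_eq_sum_trace_restrict h fun i => hU i s

end Equivalence

/-! ### The intertwining number as a dimension. -/

section Characters

variable {K S V W : Type*} [Field K] [InverseSemigroup S] [Fintype S]
  [AddCommGroup V] [Module K V] [AddCommGroup W] [Module K W]
  {e : Idem S}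

theorem floorOp_val (σ : SemigroupRep K S V) (g : MaxSubgroup e) :
    floorOp σ g.val = idemPart σ e * σ g.val := by
  rw [floorOp, g.dom_eq]

theorem floorOp_val_mul (σ : SemigroupRep K S V) (g h : MaxSubgroup e) :
    floorOp σ (g * h).val = floorOp σ g.val * floorOp σ h.val := by
  rw [floorOp_mul, if_pos (g.ran_eq.trans h.dom_eq.symm)]
  rfl

theorem floorOp_one (σ : SemigroupRep K S V) :
    floorOp σ (1 : MaxSubgroup e).val = idemPart σ e := floorOp_idem σ e

/-- The representation of `G_e` on the range of `∑_{f ≤ e} μ(f, e) σ(f)`. -/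
noncomputable def restrictBase (e : Idem S) (σ : SemigroupRep K S V) :
    Representation K (MaxSubgroup e) (LinearMap.range (idemPart σ e)) where
  toFun g := (floorOp σ g.val).restrict fun v _ => by
    rw [floorOp_val]
    exact ⟨_, rfl⟩
  map_one' := by
    ext ⟨_, v, rfl⟩
    change floorOp σ (1 : MaxSubgroup e).val (idemPart σ e v) = idemPart σ e v
    rw [floorOp_one, ← Module.End.mul_apply, idemPart_mul_self]
  map_mul' g h := by
    ext v
    change floorOp σ (g * h).val v = floorOp σ g.val (floorOp σ h.val v)
    rw [floorOp_val_mul, Module.End.mul_apply]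

theorem restrictBase_apply (σ : SemigroupRep K S V) (g : MaxSubgroup e)
    (v : LinearMap.range (idemPart σ e)) :
    (restrictBase e σ g v : V) = floorOp σ g.val v := rfl

theorem character_restrictBase [FiniteDimensional K V] (σ : SemigroupRep K S V)
    (g : MaxSubgroup e) :
    (restrictBase e σ).character g = LinearMap.trace K V (floorOp σ g.val) :=
  LinearMap.trace_restrict_eq_of_forall_mem _ _ fun v => by
    rw [floorOp_val]
    exact ⟨_, rfl⟩

/-- Expand `⌊g⌋ = ∑_{f ≤ e} μ(f, e) ρ(f)ρ(g)` under the trace and exchange the two sums. -/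
theorem intertwiningNumber_eq_pairing (χ : MaxSubgroup e → K) (σ : SemigroupRep K S V) :
    intertwiningNumber χ (character σ)
      = pairing χ fun g => LinearMap.trace K V (floorOp σ g.val) := by
  classical
  simp only [intertwiningNumber, pairing, floorOp_val, idemPart, Finset.sum_mul, map_sum,
    smul_mul_assoc, map_smul, smul_eq_mul, translate, character, map_mul, Finset.mul_sum]
  rw [Finset.sum_comm]
  refine Finset.sum_congr rfl fun g _ => Finset.sum_congr rfl fun f _ => ?_
  ring

theorem pairing_character [CharZero K] [FiniteDimensional K W] [FiniteDimensional K V]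
    {G : Type*} [Group G] [Fintype G] (φ : Representation K G W) (ψ : Representation K G V) :
    pairing φ.character ψ.character = (Module.finrank K (Representation.IntertwiningMap φ ψ) : K) := by
  have : Invertible (Nat.card G : K) :=
    invertibleOfNonzero (Nat.cast_ne_zero.2 Nat.card_pos.ne')
  rw [← Representation.card_inv_mul_sum_char_mul_char_eq_finrank φ ψ, pairing, one_div,
    Nat.card_eq_fintype_card]
  congr 1
  exact Finset.sum_congr rfl fun g _ => mul_comm _ _

theorem intertwiningNumber_eq_finrank [CharZero K] [FiniteDimensional K W] [FiniteDimensional K V]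
    (φ : Representation K (MaxSubgroup e) W) (σ : SemigroupRep K S V) :
    intertwiningNumber φ.character (character σ)
      = (Module.finrank K (Representation.IntertwiningMap φ (restrictBase e σ)) : K) := by
  rw [intertwiningNumber_eq_pairing, ← pairing_character]
  congr 1
  funext g
  rw [character_restrictBase]

/-! ### Frobenius reciprocity and the multiplicity formula. -/

variable (φ : Representation K (MaxSubgroup e) W) (p : Transversal e)

open Classical in
/-- The extension of a `G_e`-equivariant map to the space of the induced representation. -/
noncomputable def extend (σ : SemigroupRep K S V)
    (T : Representation.IntertwiningMap φ (restrictBase e σ)) :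
    ({f : Idem S // Isomorphic e f} → W) →ₗ[K] V :=
  ∑ f, floorOp σ (p.toFun f)⁻¹ ∘ₗ Submodule.subtype _ ∘ₗ T.toLinearMap ∘ₗ LinearMap.proj f

open Classical in
theorem extend_apply (σ : SemigroupRep K S V)
    (T : Representation.IntertwiningMap φ (restrictBase e σ))
    (v : {f : Idem S // Isomorphic e f} → W) :
    extend φ p σ T v = ∑ f, floorOp σ (p.toFun f)⁻¹ (T (v f) : V) := by
  simp [extend]

open Classical in
theorem extend_single (σ : SemigroupRep K S V)
    (T : Representation.IntertwiningMap φ (restrictBase e σ))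
    (f : {f : Idem S // Isomorphic e f}) (w : W) :
    extend φ p σ T (Pi.single f w) = floorOp σ (p.toFun f)⁻¹ (T w : V) := by
  rw [extend_apply, Finset.sum_eq_single f]
  · rw [Pi.single_eq_same]
  · intro g _ hg
    rw [Pi.single_eq_of_ne hg, map_zero, ZeroMemClass.coe_zero, map_zero]
  · simp

theorem coe_map_eq (σ : SemigroupRep K S V)
    (T : Representation.IntertwiningMap φ (restrictBase e σ)) (x : MaxSubgroup e) (w : W) :
    (T (φ x w) : V) = floorOp σ x.val (T w : V) := by
  rw [T.isIntertwining, restrictBase_apply]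

/-- On the block `g = ran t`, with `f = dom t`, this is `p_f⁻¹ (p_f t p_g⁻¹) = t p_g⁻¹`. All other
blocks are killed by both sides. -/
theorem extend_floorMap (σ : SemigroupRep K S V)
    (T : Representation.IntertwiningMap φ (restrictBase e σ)) (t : S)
    (v : {f : Idem S // Isomorphic e f} → W) :
    extend φ p σ T (floorMap φ p t v) = floorOp σ t (extend φ p σ T v) := by
  classical
  have hmul : ∀ f, floorOp σ t (floorOp σ (p.toFun f)⁻¹ (T (v f) : V))
      = if ran t = f.1 then floorOp σ (t * (p.toFun f)⁻¹) (T (v f) : V) else 0 := fun f => by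
    rw [← Module.End.mul_apply, floorOp_mul, dom_inv, p.ran_eq]
    split_ifs <;> rfl
  rw [extend_apply φ p σ T v, map_sum]
  simp only [hmul]
  by_cases h : Isomorphic e (dom t)
  · have h' := h.trans (isomorphic_dom_ran t)
    rw [floorMap_apply φ p ⟨_, h⟩ ⟨_, h'⟩ t rfl rfl, extend_single, coe_map_eq,
      ← Module.End.mul_apply, floorOp_mul, Finset.sum_eq_single ⟨_, h'⟩, if_pos rfl, if_pos]
    · congr 2
      change (p.toFun _)⁻¹ * (p.toFun _ * t * (p.toFun _)⁻¹) = _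
      rw [← mul_assoc, ← mul_assoc, Transversal.inv_mul_apply, dom_mul_self]
    · rw [ran_inv, p.dom_eq, MaxSubgroup.dom_eq]
    · intro f _ hf
      rw [if_neg fun h => hf (Subtype.ext h.symm)]
    · simp
  · rw [floorMap, dif_neg h, LinearMap.zero_apply, map_zero, Finset.sum_eq_zero]
    intro f _
    rw [if_neg]
    intro hf
    exact h ((hf ▸ f.2 : Isomorphic e (ran t)).trans (isomorphic_ran_dom t))

theorem extend_induced (σ : SemigroupRep K S V)
    (T : Representation.IntertwiningMap φ (restrictBase e σ)) (s : S)
    (v : {f : Idem S // Isomorphic e f} → W) :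
    extend φ p σ T (induced φ p s v) = σ s (extend φ p σ T v) := by
  classical
  rw [← sum_floorOp σ s, LinearMap.sum_apply]
  simp only [← extend_floorMap]
  rw [← map_sum, ← LinearMap.sum_apply]
  rfl

/-- On the block at `e` the extension is `⌊p_e⁻¹⌋ T`, and `⌊p_e⌋⌊p_e⁻¹⌋ = ⌊e⌋` fixes the image of
`T`, so `T` can be recovered. -/
theorem extend_ne_zero (σ : SemigroupRep K S V)
    (T : Representation.IntertwiningMap φ (restrictBase e σ)) (hT : T ≠ 0) :
    extend φ p σ T ≠ 0 := by
  classical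
  intro h
  apply hT
  refine Representation.IntertwiningMap.ext (LinearMap.ext fun w => Subtype.ext ?_)
  have h1 : floorOp σ (p.toFun (baseIndex e))⁻¹ (T w : V) = 0 := by
    rw [← extend_single φ p, h, LinearMap.zero_apply]
  have h2 : idemPart σ e (T w : V) = T w := by
    have := coe_map_eq φ σ T 1 w
    rw [floorOp_one, map_one, Module.End.one_apply] at this
    exact this.symm
  have h3 := floorOp_mul σ (p.toFun (baseIndex e)) (p.toFun (baseIndex e))⁻¹
  rw [if_pos (dom_inv _).symm, Transversal.apply_mul_inv, floorOp_idem] at h3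
  refine h2.symm.trans ((LinearMap.congr_fun h3 _).symm.trans ?_)
  rw [Module.End.mul_apply, h1, map_zero]
  rfl

theorem trace_blockUnit [FiniteDimensional K W] (f : {f : Idem S // Isomorphic e f})
    (x : MaxSubgroup e) : LinearMap.trace K _ (blockUnit φ f f x) = φ.character x := by
  classical
  rw [blockUnit, LinearMap.trace_comp_comm', Representation.character, LinearMap.comp_assoc,
    LinearMap.proj_comp_single_same, LinearMap.comp_id]

theorem trace_floorOp_induced [FiniteDimensional K W] (g : MaxSubgroup e) :
    LinearMap.trace K _ (floorOp (induced φ p) g.val) = φ.character g := by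
  rw [floorOp_induced, floorMap_eq φ p g.val (baseIndex e) (baseIndex e) g.dom_eq g.ran_eq,
    trace_blockUnit]
  -- `p_e` may be any element of `G_e`, so the block is `φ(p_e g p_e⁻¹)`; its trace is unchanged by
  -- conjugation.
  let x : MaxSubgroup e := ⟨p.toFun (baseIndex e), p.dom_eq _, p.ran_eq _⟩
  exact φ.char_conj g x

theorem intertwiningNumber_induced [CharZero K] [FiniteDimensional K W] :
    intertwiningNumber φ.character (character (induced φ p))
      = (Module.finrank K (Representation.IntertwiningMap φ φ) : K) := by
  rw [intertwiningNumber_eq_pairing, ← pairing_character]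
  simp only [trace_floorOp_induced]

-- If `σ` is not equivalent to `φ*`, Schur's lemma applied to `extend` leaves only the zero map in
-- `Hom_{G_e}(W, ⌊e⌋V)`.
open Classical in
theorem intertwiningNumber_of_isIrreducible [CharZero K] [FiniteDimensional K W]
    [FiniteDimensional K V] (hφ : φ.IsIrreducible) {σ : SemigroupRep K S V}
    (hσ : IsIrreducible σ) :
    intertwiningNumber φ.character (character σ)
      = if Equivalent σ (induced φ p)
        then (Module.finrank K (Representation.IntertwiningMap φ φ) : K) else 0 := by
  split_ifs with h
  · rw [h.character_eq, intertwiningNumber_induced]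
  · have : Subsingleton (Representation.IntertwiningMap φ (restrictBase e σ)) :=
      subsingleton_of_forall_eq 0 fun T => by
        by_contra hT
        exact h (equivalent_of_ne_zero (induced_isIrreducible φ p hφ) hσ (extend φ p σ T)
          (extend_induced φ p σ T) (extend_ne_zero φ p σ T hT)).symm
    rw [intertwiningNumber_eq_finrank, Module.finrank_zero_of_subsingleton, Nat.cast_zero]

theorem intertwiningNumber_sum {ι : Type*} [Fintype ι] (χ : MaxSubgroup e → K) (θ : ι → S → K) :
    intertwiningNumber χ (fun s => ∑ i, θ i s) = ∑ i, intertwiningNumber χ (θ i) := by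
  classical
  simp only [intertwiningNumber, pairing, translate, Finset.mul_sum, Finset.sum_mul]
  conv_rhs => rw [Finset.sum_comm]
  exact Finset.sum_congr rfl fun f _ => Finset.sum_comm

theorem intertwiningNumber_eq_mul [CharZero K] [FiniteDimensional K W] [FiniteDimensional K V]
    (hφ : φ.IsIrreducible) (ρ : SemigroupRep K S V) {m : ℕ}
    (hm : IsMultiplicity (induced φ p) ρ m) :
    intertwiningNumber φ.character (character ρ)
      = (m : K) * (Module.finrank K (Representation.IntertwiningMap φ φ) : K) := by
  classical
  obtain ⟨k, U, hU, hint, hirr, rfl⟩ := hm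
  rw [character_eq_sum ρ hU hint, intertwiningNumber_sum]
  simp only [fun i => intertwiningNumber_of_isIrreducible φ p hφ (hirr i)]
  rw [← Finset.sum_filter, Finset.sum_const, nsmul_eq_mul, Nat.card_eq_fintype_card,
    Fintype.card_subtype]

end Characters

end InverseSemigroup

open Classical in
theorem theorem5p1 {K S V W : Type*} [Field K] [CharZero K] [InverseSemigroup S] [Fintype S]
    [AddCommGroup V] [Module K V] [FiniteDimensional K V]
    [AddCommGroup W] [Module K W] [FiniteDimensional K W]
    (e : InverseSemigroup.Idem S)
    (ρ : InverseSemigroup.SemigroupRep K S V)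
    (φ : Representation K (InverseSemigroup.MaxSubgroup e) W) (hφ : φ.IsIrreducible)
    (p : InverseSemigroup.Transversal e) :
    InverseSemigroup.IsIrreducible (InverseSemigroup.induced φ p) ∧
    (∃ m : ℕ, InverseSemigroup.IsMultiplicity (InverseSemigroup.induced φ p) ρ m) ∧
    ∀ m d : ℕ, InverseSemigroup.IsMultiplicity (InverseSemigroup.induced φ p) ρ m →
      d = Module.finrank K (Representation.IntertwiningMap φ φ) →
      InverseSemigroup.intertwiningNumber φ.character (InverseSemigroup.character ρ) =
        ∑ f : InverseSemigroup.Idem S with f ≤ e,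
          InverseSemigroup.pairing φ.character
            (InverseSemigroup.translate (InverseSemigroup.character ρ) f e) *
              InverseSemigroup.moebius K f e ∧
      ∑ f : InverseSemigroup.Idem S with f ≤ e,
          InverseSemigroup.pairing φ.character
            (InverseSemigroup.translate (InverseSemigroup.character ρ) f e) *
              InverseSemigroup.moebius K f e = (m : K) * (d : K) := by
  refine ⟨InverseSemigroup.induced_isIrreducible φ p hφ, ?_, ?_⟩
  · obtain ⟨k, U, hU, hint, hirr⟩ := InverseSemigroup.exists_isInternal_isIrreducible ρ
    exact ⟨_, k, U, hU, hint, hirr, rfl⟩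
  · rintro m d hm rfl
    exact ⟨rfl, InverseSemigroup.intertwiningNumber_eq_mul φ p hφ ρ hm⟩
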